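/- Consider the Gaussian sequence model $Y_i=\mu_i+\xi_i$, $i=1,\dots,n$, where the $\xi_i\sim N(0,\sigma^2)$ are i.i.d. with $\sigma>0$ and $\mu$ lies in a set $K\subset\mathbb R^n$. The minimax risk over $K$ is $$R(\sigma,K)=\inf_{\hat\nu}\ \sup_{\mu\in K}\ \mathbb E\,\|\hat\nu(Y)-\mu\|^2 ,$$ where $\|\cdot\|$ is the Euclidean norm and the infimum is over all measurable functions $\hat\nu:\mathbb R^n\to\mathbb R^n$. There are absolute constants $0<c,C<\infty$ such that the following holds for all $n$, all $\sigma>0$ and all $0<a_1\le a_2\le\dots\le a_n$. Let $K=\prod_{i=1}^n[-a_i/2,a_i/2]$ and $d^2=\sum_{i=1}^n a_i^2$. 1. If $\sigma^2\le d^2$, there is exactly one $k\in\{0,\dots,n-1\}$ with $$(k+1)\sigma^2\le\sum_{i=1}^{n-k}a_i^2\qquad\text{and}\qquad (k+2)\sigma^2>\sum_{i=1}^{n-k-1}a_i^2. \tag{$*$}$$ 2. If $k\in\{0,\dots,n-1\}$ satisfies $(*)$, then $$c\,\min\{(k+2)\sigma^2,\,d^2\}\ \le\ R(\sigma,K)\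 \le\ C\,\min\{(k+2)\sigma^2,\,d^2\}.$$ 3. If $d^2\le\sigma^2$, then $c\,d^2\le R(\sigma,K)\le C\,d^2$. -/

import Mathlib

open MeasureTheory ProbabilityTheory
open scoped ENNReal

/-- The law of the observation `Y = μ + ξ` in the Gaussian sequence model, where the coordinates
`ξ i` of the noise are i.i.d. `N(0, σ²)`: the coordinates `Y i ~ N(μ i, σ²)` are independent. -/
noncomputable def gaussianSequenceLaw {n : ℕ} (σ : ℝ) (μ : EuclideanSpace ℝ (Fin n)) :
    Measure (EuclideanSpace ℝ (Fin n)) :=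
  (Measure.pi fun i : Fin n => gaussianReal (μ i) (Real.toNNReal (σ ^ 2))).map (WithLp.toLp 2)

/-- The minimax risk `inf_ν sup_{μ ∈ K} E ‖ν(Y) - μ‖²` under squared Euclidean loss, the infimum
being over all measurable functions (estimators) of the data. The expectation is a Lebesgue
integral with values in `[0, ∞]`, so an estimator of infinite risk does count as infinitely bad. -/
noncomputable def gaussianMinimaxRisk {n : ℕ} (σ : ℝ) (K : Set (EuclideanSpace ℝ (Fin n))) : ℝ≥0∞ :=
  ⨅ (ν : EuclideanSpace ℝ (Fin n) → EuclideanSpace ℝ (Fin n)) (_ : Measurable ν),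
    ⨆ μ ∈ K, ∫⁻ y, ‖ν y - μ‖ₑ ^ 2 ∂(gaussianSequenceLaw σ μ)

/-- The hyperrectangle `∏ i, [-a i / 2, a i / 2]`. -/
def hyperrectangle {n : ℕ} (a : Fin n → ℝ) : Set (EuclideanSpace ℝ (Fin n)) :=
  {x | ∀ i, x i ∈ Set.Icc (-(a i / 2)) (a i / 2)}

/-- The sum `a_1² + … + a_m²` of the first `m` squared side lengths (`Fin n` is indexed from `0`,
so `a_1` is `a 0`). -/
noncomputable def headSqSum {n : ℕ} (a : Fin n → ℝ) (m : ℕ) : ℝ :=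
  ∑ i ∈ (Finset.univ.filter fun i : Fin n => (i : ℕ) < m), a i ^ 2

/-- The index `k ∈ {0, …, n - 1}` satisfies `(k + 1) σ² ≤ a_1² + … + a_{n-k}²` and
`(k + 2) σ² > a_1² + … + a_{n-k-1}²`. The subtractions do not truncate since `k < n`. -/
def IsCriticalIndex {n : ℕ} (σ : ℝ) (a : Fin n → ℝ) (k : ℕ) : Prop :=
  k < n ∧ ((k : ℝ) + 1) * σ ^ 2 ≤ headSqSum a (n - k) ∧
    headSqSum a (n - k - 1) < ((k : ℝ) + 2) * σ ^ 2

/-! The risk is comparable to `∑ min (a i ^ 2) (σ ^ 2)`. Above, estimate coordinate `i` by `0` or by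
`y i` (`gaussianMinimaxRisk_hyperrectangle_le`). Below, use Assouad's argument on a cube of sign
vectors (`gaussianMinimaxRisk_ge_of_cube`). At a critical index that sum agrees with `(k + 2) σ² ∧
d²` up to a factor 2. -/

/-! ### Lower bound over a cube -/

/-- A common minorant for the laws with means `±s`. Halving the variance turns the difference of
exponents into a square, at the cost of a factor `exp (-1) / √2 > 1 / 4`. -/
theorem smul_gaussianReal_zero_le {σ s : ℝ} (hσ : 0 < σ) (hs : s ^ 2 ≤ σ ^ 2) :
    ENNReal.ofReal (1 / 4) • gaussianReal 0 (Real.toNNReal (σ ^ 2 / 2))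
      ≤ gaussianReal s (Real.toNNReal (σ ^ 2)) := by
  have hv : 0 < σ ^ 2 := by positivity
  rw [gaussianReal_of_var_ne_zero _ (by simpa using by positivity),
    gaussianReal_of_var_ne_zero _ (by simpa using by positivity),
    ← withDensity_smul _ (measurable_gaussianPDF _ _)]
  refine withDensity_mono (ae_of_all _ fun x => ?_)
  simp only [Pi.smul_apply, smul_eq_mul, gaussianPDF]
  rw [← ENNReal.ofReal_mul (by norm_num)]
  refine ENNReal.ofReal_le_ofReal ?_
  rw [gaussianPDFReal, gaussianPDFReal, Real.coe_toNNReal _ hv.le,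
    Real.coe_toNNReal _ (half_pos hv).le]
  have h1 : √(2 * Real.pi * σ ^ 2) = √2 * √(2 * Real.pi * (σ ^ 2 / 2)) := by
    rw [← Real.sqrt_mul (by norm_num)]; congr 1; ring
  have h2 : Real.exp (-1) * Real.exp (-(x - 0) ^ 2 / (2 * (σ ^ 2 / 2)))
      ≤ Real.exp (-(x - s) ^ 2 / (2 * σ ^ 2)) := by
    rw [← Real.exp_add, Real.exp_le_exp]
    have : -(x - s) ^ 2 / (2 * σ ^ 2) - (-1 + -(x - 0) ^ 2 / (2 * (σ ^ 2 / 2)))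
        = ((x + s) ^ 2 + 2 * (σ ^ 2 - s ^ 2)) / (2 * σ ^ 2) := by
      field_simp; ring
    have h3 : 0 ≤ ((x + s) ^ 2 + 2 * (σ ^ 2 - s ^ 2)) / (2 * σ ^ 2) :=
      div_nonneg (by nlinarith [sq_nonneg (x + s)]) (by positivity)
    linarith
  have h4 : 1 / 4 * √2 ≤ Real.exp (-1) := by
    have hs2 : √2 ≤ 1.42 := Real.sqrt_le_iff.2 ⟨by norm_num, by norm_num⟩
    have he : Real.exp 1 < 2.7182818286 := Real.exp_one_lt_d9
    rw [Real.exp_neg, ← one_div, le_div_iff₀ (Real.exp_pos 1)]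
    nlinarith [Real.exp_pos 1]
  rw [h1, mul_inv]
  set A := (√(2 * Real.pi * (σ ^ 2 / 2)))⁻¹
  set B := Real.exp (-(x - 0) ^ 2 / (2 * (σ ^ 2 / 2)))
  have hA : 0 ≤ A := by positivity
  have hB : 0 ≤ B := by positivity
  have h5 : (1 / 4 : ℝ) = (√2)⁻¹ * (1 / 4 * √2) := by field_simp
  calc 1 / 4 * (A * B) = (√2)⁻¹ * A * ((1 / 4 * √2) * B) := by
        conv_lhs => rw [h5]
        ring
    _ ≤ (√2)⁻¹ * A * (Real.exp (-1) * B) := by gcongr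
    _ ≤ _ := by gcongr

theorem enorm_sq_eq_ofReal (x : ℝ) : ‖x‖ₑ ^ 2 = ENNReal.ofReal (x ^ 2) := by
  rw [← ofReal_norm, ← ENNReal.ofReal_pow (norm_nonneg _), Real.norm_eq_abs, sq_abs]

theorem enorm_sq_eq_sum_coord {n : ℕ} (x : EuclideanSpace ℝ (Fin n)) :
    ‖x‖ₑ ^ 2 = ∑ i, ‖x i‖ₑ ^ 2 := by
  simp_rw [enorm_sq_eq_ofReal]
  rw [← ENNReal.ofReal_sum_of_nonneg fun i _ => sq_nonneg _, ← ofReal_norm,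
    ← ENNReal.ofReal_pow (norm_nonneg _), EuclideanSpace.norm_sq_eq]
  simp

/-- Estimating the sign of a mean `±t` that is no larger than the noise level has risk of order
`t ^ 2`. -/
theorem two_point_risk_lower_bound {σ t : ℝ} (hσ : 0 < σ) (ht : t ^ 2 ≤ σ ^ 2) {g : ℝ → ℝ}
    (hg : Measurable g) :
    ENNReal.ofReal (t ^ 2 / 2) ≤
      ∫⁻ x, ‖g x - t‖ₑ ^ 2 ∂(gaussianReal t (Real.toNNReal (σ ^ 2))) +
      ∫⁻ x, ‖g x - -t‖ₑ ^ 2 ∂(gaussianReal (-t) (Real.toNNReal (σ ^ 2))) := by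
  have h1 := lintegral_mono' (smul_gaussianReal_zero_le hσ ht)
    (le_refl fun x => ‖g x - t‖ₑ ^ 2)
  have h2 := lintegral_mono' (smul_gaussianReal_zero_le (s := -t) hσ (by simpa using ht))
    (le_refl fun x => ‖g x - -t‖ₑ ^ 2)
  refine le_trans ?_ (add_le_add h1 h2)
  rw [lintegral_smul_measure, lintegral_smul_measure, smul_eq_mul, smul_eq_mul, ← mul_add,
    ← lintegral_add_left (by fun_prop)]
  calc ENNReal.ofReal (t ^ 2 / 2)
      = ENNReal.ofReal (1 / 4) * ∫⁻ _, ENNReal.ofReal (2 * t ^ 2)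
          ∂(gaussianReal 0 (Real.toNNReal (σ ^ 2 / 2))) := by
        rw [lintegral_const, measure_univ, mul_one, ← ENNReal.ofReal_mul (by norm_num)]
        congr 1; ring
    _ ≤ _ := by
        gcongr with x
        rw [enorm_sq_eq_ofReal, enorm_sq_eq_ofReal,
          ← ENNReal.ofReal_add (sq_nonneg _) (sq_nonneg _)]
        -- `(g - t)² + (g + t)² = 2 g² + 2 t²`.
        exact ENNReal.ofReal_le_ofReal (by nlinarith [sq_nonneg (g x)])

/-- By Fubini: the other coordinates have the same law under `θ` and `θ'`, and with them frozen the
two-point bound applies. -/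
theorem coord_risk_lower_bound {n : ℕ} {σ : ℝ} (hσ : 0 < σ) (i : Fin n)
    {f : (Fin n → ℝ) → ℝ} (hf : Measurable f) {θ θ' : Fin n → ℝ}
    (hne : ∀ j, j ≠ i → θ' j = θ j) (hi : θ' i = -θ i) (ht : θ i ^ 2 ≤ σ ^ 2) :
    ENNReal.ofReal (θ i ^ 2 / 2) ≤
      ∫⁻ y, ‖f y - θ i‖ₑ ^ 2
        ∂(Measure.pi fun j => gaussianReal (θ j) (Real.toNNReal (σ ^ 2))) +
      ∫⁻ y, ‖f y - θ' i‖ₑ ^ 2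
        ∂(Measure.pi fun j => gaussianReal (θ' j) (Real.toNNReal (σ ^ 2))) := by
  cases n with
  | zero => exact i.elim0
  | succ m =>
    have key : ∀ (η : Fin (m + 1) → ℝ) (s : ℝ),
        ∫⁻ y, ‖f y - s‖ₑ ^ 2
            ∂(Measure.pi fun j => gaussianReal (η j) (Real.toNNReal (σ ^ 2))) =
          ∫⁻ z, ∫⁻ x, ‖f ((MeasurableEquiv.piFinSuccAbove (fun _ => ℝ) i).symm (x, z)) - s‖ₑ ^ 2
            ∂(gaussianReal (η i) (Real.toNNReal (σ ^ 2)))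
            ∂(Measure.pi fun j => gaussianReal (η (i.succAbove j)) (Real.toNNReal (σ ^ 2))) := by
      intro η s
      rw [← lintegral_prod_symm
        (fun p : ℝ × (Fin m → ℝ) =>
          ‖f ((MeasurableEquiv.piFinSuccAbove (fun _ => ℝ) i).symm p) - s‖ₑ ^ 2)
        (by fun_prop)]
      exact (((measurePreserving_piFinSuccAbove
        (fun j => gaussianReal (η j) (Real.toNNReal (σ ^ 2))) i).symm).lintegral_comp
          (f := fun y => ‖f y - s‖ₑ ^ 2) (by fun_prop)).symm
    have hrest : ∀ j, θ' (i.succAbove j) = θ (i.succAbove j) :=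
      fun j => hne _ (Fin.succAbove_ne i j)
    rw [key, key]
    simp_rw [hrest, hi]
    rw [← lintegral_add_left]
    · calc ENNReal.ofReal (θ i ^ 2 / 2)
          = ∫⁻ _, ENNReal.ofReal (θ i ^ 2 / 2) ∂(Measure.pi fun j =>
              gaussianReal (θ (i.succAbove j)) (Real.toNNReal (σ ^ 2))) := by simp
        _ ≤ _ := by
          gcongr with z
          exact two_point_risk_lower_bound hσ ht
            (g := fun x => f ((MeasurableEquiv.piFinSuccAbove (fun _ => ℝ) i).symm (x, z)))
            (by fun_prop)
    · exact Measurable.lintegral_prod_left'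
        (f := fun p : ℝ × (Fin m → ℝ) =>
          ‖f ((MeasurableEquiv.piFinSuccAbove (fun _ => ℝ) i).symm p) - θ i‖ₑ ^ 2) (by fun_prop)

theorem lintegral_gaussianSequenceLaw {n : ℕ} (σ : ℝ) {ν : EuclideanSpace ℝ (Fin n) →
    EuclideanSpace ℝ (Fin n)} (hν : Measurable ν) (μ : EuclideanSpace ℝ (Fin n)) :
    ∫⁻ y, ‖ν y - μ‖ₑ ^ 2 ∂(gaussianSequenceLaw σ μ) =
      ∑ i, ∫⁻ y, ‖ν (WithLp.toLp 2 y) i - μ i‖ₑ ^ 2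
        ∂(Measure.pi fun j => gaussianReal (μ j) (Real.toNNReal (σ ^ 2))) := by
  have hcoord : ∀ i, Measurable fun y : Fin n → ℝ => ν (WithLp.toLp 2 y) i := fun i => by
    fun_prop
  rw [gaussianSequenceLaw, lintegral_map (by fun_prop) (by fun_prop),
    ← lintegral_finsetSum _ fun i _ => ((hcoord i).sub_const _).enorm.pow_const 2]
  simp_rw [enorm_sq_eq_sum_coord, PiLp.sub_apply]

/-- The supremum dominates the average over vertices. Flipping sign `i` pairs the vertices, and each
pair contributes `t i ^ 2 / 2`, hence `t i ^ 2 / 4` on average. -/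
theorem gaussianMinimaxRisk_ge_of_cube {n : ℕ} {σ : ℝ} (hσ : 0 < σ)
    (K : Set (EuclideanSpace ℝ (Fin n))) (t : Fin n → ℝ) (ht : ∀ i, t i ^ 2 ≤ σ ^ 2)
    (hK : ∀ ε : Fin n → Bool, WithLp.toLp 2 (fun i => if ε i then t i else -t i) ∈ K) :
    ENNReal.ofReal (∑ i, t i ^ 2 / 4) ≤ gaussianMinimaxRisk σ K := by
  refine le_iInf₂ fun ν hν => ?_
  set S := ⨆ μ ∈ K, ∫⁻ y, ‖ν y - μ‖ₑ ^ 2 ∂(gaussianSequenceLaw σ μ)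
  let θ : (Fin n → Bool) → Fin n → ℝ := fun ε i => if ε i then t i else -t i
  let r : Fin n → (Fin n → Bool) → ℝ≥0∞ := fun i ε =>
    ∫⁻ y, ‖ν (WithLp.toLp 2 y) i - θ ε i‖ₑ ^ 2
      ∂(Measure.pi fun j => gaussianReal (θ ε j) (Real.toNNReal (σ ^ 2)))
  have hle : ∀ ε, ∑ i, r i ε ≤ S := fun ε => by
    have := le_iSup₂ (f := fun μ (_ : μ ∈ K) =>
      ∫⁻ y, ‖ν y - μ‖ₑ ^ 2 ∂(gaussianSequenceLaw σ μ)) _ (hK ε)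
    rw [lintegral_gaussianSequenceLaw σ hν] at this
    exact this
  have hsq : ∀ ε i, θ ε i ^ 2 = t i ^ 2 := fun ε i => by
    simp only [θ]; split_ifs <;> simp
  have hpair : ∀ i, (Fintype.card (Fin n → Bool) : ℝ≥0∞) * ENNReal.ofReal (t i ^ 2 / 2)
      ≤ 2 * ∑ ε, r i ε := fun i => by
    let flip : Equiv.Perm (Fin n → Bool) := Function.Involutive.toPerm
      (fun ε => Function.update ε i (!ε i)) (fun ε => by simp)
    have hflip : ∀ ε, flip ε = Function.update ε i (!ε i) := fun _ => rfl
    calc (Fintype.card (Fin n → Bool) : ℝ≥0∞) * ENNReal.ofReal (t i ^ 2 / 2)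
        = ∑ _ε : Fin n → Bool, ENNReal.ofReal (t i ^ 2 / 2) := by
          rw [Finset.sum_const, nsmul_eq_mul, Finset.card_univ]
      _ ≤ ∑ ε, (r i ε + r i (flip ε)) := by
          refine Finset.sum_le_sum fun ε _ => ?_
          rw [← hsq ε i]
          refine coord_risk_lower_bound hσ i (by fun_prop) (fun j hj => ?_) ?_
            ((hsq ε i).trans_le (ht i))
          · simp [θ, hflip, hj]
          · simp only [θ, hflip, Function.update_self]
            cases ε i <;> simp
      _ = 2 * ∑ ε, r i ε := by
          rw [Finset.sum_add_distrib, Equiv.sum_comp flip (r i), two_mul]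
  have hsum : (Fintype.card (Fin n → Bool) : ℝ≥0∞) * (2 * ENNReal.ofReal (∑ i, t i ^ 2 / 4))
      ≤ (Fintype.card (Fin n → Bool) : ℝ≥0∞) * (2 * S) := by
    calc (Fintype.card (Fin n → Bool) : ℝ≥0∞) * (2 * ENNReal.ofReal (∑ i, t i ^ 2 / 4))
        = ∑ i, (Fintype.card (Fin n → Bool) : ℝ≥0∞) * ENNReal.ofReal (t i ^ 2 / 2) := by
          rw [← Finset.mul_sum, ← ENNReal.ofReal_sum_of_nonneg fun i _ => by positivity,
            ← ENNReal.ofReal_ofNat, ← ENNReal.ofReal_mul (by norm_num), Finset.mul_sum]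
          congr 3 with i
          ring
      _ ≤ ∑ i, 2 * ∑ ε, r i ε := Finset.sum_le_sum fun i _ => hpair i
      _ = 2 * ∑ ε, ∑ i, r i ε := by rw [← Finset.mul_sum, Finset.sum_comm]
      _ ≤ 2 * ∑ _ε : Fin n → Bool, S := by gcongr with ε; exact hle ε
      _ = (Fintype.card (Fin n → Bool) : ℝ≥0∞) * (2 * S) := by
          rw [Finset.sum_const, nsmul_eq_mul, Finset.card_univ]; ring
  rwa [ENNReal.mul_le_mul_iff_right (by simp) (by simp),
    ENNReal.mul_le_mul_iff_right (by simp) (by simp)] at hsum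

/-! ### Risk of the hyperrectangle -/

theorem lintegral_sq_sub_mean_gaussianReal (σ m : ℝ) :
    ∫⁻ x, ‖x - m‖ₑ ^ 2 ∂(gaussianReal m (Real.toNNReal (σ ^ 2))) = ENNReal.ofReal (σ ^ 2) := by
  have h := ofReal_variance (memLp_id_gaussianReal (μ := m) (v := Real.toNNReal (σ ^ 2)) 2)
  rw [variance_id_gaussianReal, Real.coe_toNNReal _ (sq_nonneg σ)] at h
  simpa [evariance] using h.symm

theorem gaussianMinimaxRisk_hyperrectangle_le {n : ℕ} {a : Fin n → ℝ} {σ : ℝ} :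
    gaussianMinimaxRisk σ (hyperrectangle a) ≤
      ENNReal.ofReal (∑ i, min (a i ^ 2) (σ ^ 2)) := by
  let ν : EuclideanSpace ℝ (Fin n) → EuclideanSpace ℝ (Fin n) := fun y =>
    WithLp.toLp 2 fun i => if a i ^ 2 ≤ σ ^ 2 then 0 else y i
  have hν : Measurable ν := by
    refine (WithLp.measurable_toLp 2 _).comp (measurable_pi_lambda _ fun i => ?_)
    split_ifs <;> fun_prop
  refine (iInf₂_le ν hν).trans (iSup₂_le fun μ hμ => ?_)
  rw [lintegral_gaussianSequenceLaw σ hν,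
    ENNReal.ofReal_sum_of_nonneg fun i _ => le_min (sq_nonneg _) (sq_nonneg _)]
  refine Finset.sum_le_sum fun i _ => ?_
  by_cases h : a i ^ 2 ≤ σ ^ 2
  · obtain ⟨h1, h2⟩ := hμ i
    simp only [ν, h, if_true, zero_sub, enorm_neg, lintegral_const, measure_univ, mul_one,
      min_eq_left, enorm_sq_eq_ofReal]
    exact ENNReal.ofReal_le_ofReal (by nlinarith)
  · simp only [ν, h, if_false]
    rw [min_eq_right (not_le.1 h).le, ← lintegral_sq_sub_mean_gaussianReal σ (μ i)]
    exact ((measurePreserving_eval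
      (fun j => gaussianReal (μ j) (Real.toNNReal (σ ^ 2))) i).lintegral_comp
        (f := fun x => ‖x - μ i‖ₑ ^ 2) (by fun_prop)).le

theorem le_gaussianMinimaxRisk_hyperrectangle {n : ℕ} {a : Fin n → ℝ} {σ : ℝ} (hσ : 0 < σ)
    (ha : ∀ i, 0 < a i) :
    ENNReal.ofReal (1 / 16 * ∑ i, min (a i ^ 2) (σ ^ 2)) ≤
      gaussianMinimaxRisk σ (hyperrectangle a) := by
  have hpos : ∀ i, 0 ≤ min (a i / 2) σ := fun i => le_min (half_pos (ha i)).le hσ.le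
  -- The largest cube within both the box and the noise level; `(a i / 2)² / 4` gives the `1 / 16`.
  refine le_trans (ENNReal.ofReal_le_ofReal ?_) (gaussianMinimaxRisk_ge_of_cube hσ
    (hyperrectangle a) (fun i => min (a i / 2) σ) (fun i => ?_) fun ε i => ?_)
  · rw [Finset.mul_sum]
    refine Finset.sum_le_sum fun i _ => ?_
    have := ha i
    rcases min_cases (a i / 2) σ with ⟨h, _⟩ | ⟨h, _⟩ <;> rw [h]
    · linarith [min_le_left (a i ^ 2) (σ ^ 2)]
    · linarith [min_le_right (a i ^ 2) (σ ^ 2), sq_nonneg σ]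
  · exact pow_le_pow_left₀ (hpos i) (min_le_right _ _) 2
  · have h1 := hpos i
    have h2 := min_le_left (a i / 2) σ
    simp only [Set.mem_Icc]
    split_ifs <;> constructor <;> linarith

/-! ### The critical index -/

theorem headSqSum_mono {n : ℕ} (a : Fin n → ℝ) : Monotone (headSqSum a) := fun _ _ h =>
  Finset.sum_le_sum_of_subset_of_nonneg
    (fun i hi => by simp only [Finset.mem_filter] at hi ⊢; exact ⟨hi.1, hi.2.trans_le h⟩)
    fun _ _ _ => sq_nonneg _

theorem headSqSum_self {n : ℕ} (a : Fin n → ℝ) : headSqSum a n = ∑ i, a i ^ 2 := by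
  simp [headSqSum]

theorem headSqSum_zero {n : ℕ} (a : Fin n → ℝ) : headSqSum a 0 = 0 := by
  simp [headSqSum]

/-- The first inequality at `k + 1` negates the second at `k`, so the least `k` satisfying the
second works. -/
theorem existsUnique_isCriticalIndex {n : ℕ} {a : Fin n → ℝ} {σ : ℝ} (hσ : 0 < σ)
    (h : σ ^ 2 ≤ ∑ i, a i ^ 2) : ∃! k : ℕ, IsCriticalIndex σ a k := by
  classical
  have hv : 0 < σ ^ 2 := by positivity
  have hex : ∃ k : ℕ, headSqSum a (n - k - 1) < ((k : ℝ) + 2) * σ ^ 2 :=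
    -- Truncated subtraction makes the head sum empty here; `k < n` is recovered below.
    ⟨n, by simp only [Nat.sub_self, Nat.zero_sub, headSqSum_zero]; positivity⟩
  have hlower : ((Nat.find hex : ℕ) + 1 : ℝ) * σ ^ 2 ≤ headSqSum a (n - Nat.find hex) := by
    rcases hk : Nat.find hex with _ | j
    · simpa [headSqSum_self] using h
    · have := Nat.find_min hex (m := j) (by omega)
      rw [not_lt, Nat.sub_sub] at this
      push_cast
      linarith
  refine ⟨Nat.find hex, ⟨?_, hlower, Nat.find_spec hex⟩, fun k hk => ?_⟩
  · by_contra hn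
    rw [Nat.sub_eq_zero_of_le (not_lt.1 hn), headSqSum_zero] at hlower
    have : 0 < ((Nat.find hex : ℕ) + 1 : ℝ) * σ ^ 2 := by positivity
    linarith
  · refine le_antisymm (not_lt.1 fun hlt => ?_) (Nat.find_min' hex hk.2.2)
    have h1 := headSqSum_mono a (show n - k ≤ n - Nat.find hex - 1 by omega)
    have h2 : ((Nat.find hex : ℕ) + 1 : ℝ) ≤ k := by exact_mod_cast hlt
    nlinarith [hk.2.1, Nat.find_spec hex]

theorem sum_min_le_of_isCriticalIndex {n : ℕ} {a : Fin n → ℝ} {σ : ℝ} {k : ℕ}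
    (hk : IsCriticalIndex σ a k) :
    ∑ i, min (a i ^ 2) (σ ^ 2) ≤ 2 * min (((k : ℝ) + 2) * σ ^ 2) (∑ i, a i ^ 2) := by
  have hd : ∑ i, min (a i ^ 2) (σ ^ 2) ≤ ∑ i, a i ^ 2 :=
    Finset.sum_le_sum fun i _ => min_le_left _ _
  have hd0 : 0 ≤ ∑ i, a i ^ 2 := Finset.sum_nonneg fun i _ => sq_nonneg _
  rw [mul_min_of_nonneg _ _ (by norm_num)]
  refine le_min ?_ (by linarith)
  have hcard : ((Finset.univ.filter fun i : Fin n => ¬ (i : ℕ) < n - k - 1).card : ℝ) ≤ k + 1 := by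
    have h1 := Finset.card_filter_add_card_filter_not (s := (Finset.univ : Finset (Fin n)))
      (fun i : Fin n => (i : ℕ) < n - k - 1)
    have h2 : (Finset.univ.filter fun i : Fin n => (i : ℕ) < n - k - 1).card = n - k - 1 := by
      rw [Fin.card_filter_val_lt]; omega
    rw [Finset.card_univ, Fintype.card_fin] at h1
    have := hk.1
    exact_mod_cast (by omega : _ ≤ k + 1)
  -- The head is below `(k + 2) σ²` and the other `k + 1` terms are at most `σ²` each.
  rw [← Finset.sum_filter_add_sum_filter_not _ (fun i : Fin n => (i : ℕ) < n - k - 1)]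
  have h1 : ∑ i ∈ Finset.univ.filter (fun i : Fin n => (i : ℕ) < n - k - 1),
      min (a i ^ 2) (σ ^ 2) ≤ headSqSum a (n - k - 1) :=
    Finset.sum_le_sum fun i _ => min_le_left _ _
  have h2 : ∑ i ∈ Finset.univ.filter (fun i : Fin n => ¬ (i : ℕ) < n - k - 1),
      min (a i ^ 2) (σ ^ 2) ≤ (k + 1) * σ ^ 2 := by
    refine (Finset.sum_le_card_nsmul _ _ (σ ^ 2) fun i _ => min_le_right _ _).trans ?_
    rw [nsmul_eq_mul]
    gcongr
  nlinarith [hk.2.2, sq_nonneg σ]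

theorem min_le_sum_min_of_isCriticalIndex {n : ℕ} {a : Fin n → ℝ} {σ : ℝ} (hσ : 0 < σ)
    (ha : ∀ i, 0 < a i) (hmono : Monotone a) {k : ℕ} (hk : IsCriticalIndex σ a k) :
    min (((k : ℝ) + 2) * σ ^ 2) (∑ i, a i ^ 2) ≤ 2 * ∑ i, min (a i ^ 2) (σ ^ 2) := by
  refine (min_le_left _ _).trans ?_
  suffices h : ((k : ℝ) + 1) * σ ^ 2 ≤ ∑ i, min (a i ^ 2) (σ ^ 2) by
    nlinarith [mul_nonneg k.cast_nonneg (sq_nonneg σ)]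
  have hnn : ∀ i, 0 ≤ min (a i ^ 2) (σ ^ 2) := fun i => le_min (sq_nonneg _) (sq_nonneg _)
  have hkn := hk.1
  let p : Fin n := ⟨n - k - 1, by omega⟩
  -- `p` is the last of the first `n - k` sides. If `a p ≤ σ`, none of these is clipped; otherwise
  -- the last `k + 1` terms all equal `σ²`.
  rcases le_total (a p) σ with hp | hp
  · refine hk.2.1.trans ((Finset.sum_le_sum fun i hi => ?_).trans
      (Finset.sum_le_sum_of_subset_of_nonneg (Finset.filter_subset _ _) fun i _ _ => hnn i))
    have hip : i ≤ p := by
      simp only [Finset.mem_filter, Finset.mem_univ, true_and] at hi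
      exact Fin.le_def.2 (by simp only [p]; omega)
    exact le_min le_rfl (pow_le_pow_left₀ (ha i).le ((hmono hip).trans hp) 2)
  · calc ((k : ℝ) + 1) * σ ^ 2 = ∑ i ∈ Finset.Ici p, σ ^ 2 := by
          rw [Finset.sum_const, nsmul_eq_mul, Fin.card_Ici]
          congr 1
          rw [show n - (p : ℕ) = k + 1 by simp only [p]; omega]
          push_cast; rfl
      _ ≤ ∑ i ∈ Finset.Ici p, min (a i ^ 2) (σ ^ 2) := Finset.sum_le_sum fun i hi =>
          le_min (pow_le_pow_left₀ hσ.le (hp.trans (hmono (Finset.mem_Ici.1 hi))) 2) le_rfl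
      _ ≤ _ := Finset.sum_le_sum_of_subset_of_nonneg (Finset.subset_univ _) fun i _ _ => hnn i

theorem mainTheorem5 :
    ∃ c C : ℝ, 0 < c ∧ 0 < C ∧
      ∀ (n : ℕ) (a : Fin n → ℝ) (σ : ℝ), 0 < σ → (∀ i, 0 < a i) → Monotone a →
        -- if `σ² ≤ d²`, there is exactly one critical index
        (σ ^ 2 ≤ ∑ i, a i ^ 2 → ∃! k : ℕ, IsCriticalIndex σ a k) ∧
        -- at the critical index `k`, the rate is `(k + 2) σ² ∧ d²`
        (∀ k : ℕ, IsCriticalIndex σ a k →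
          ENNReal.ofReal (c * min (((k : ℝ) + 2) * σ ^ 2) (∑ i, a i ^ 2))
              ≤ gaussianMinimaxRisk σ (hyperrectangle a) ∧
            gaussianMinimaxRisk σ (hyperrectangle a)
              ≤ ENNReal.ofReal (C * min (((k : ℝ) + 2) * σ ^ 2) (∑ i, a i ^ 2))) ∧
        -- if `d² ≤ σ²`, the rate is `d²`
        (∑ i, a i ^ 2 ≤ σ ^ 2 →
          ENNReal.ofReal (c * ∑ i, a i ^ 2) ≤ gaussianMinimaxRisk σ (hyperrectangle a) ∧
            gaussianMinimaxRisk σ (hyperrectangle a) ≤ ENNReal.ofReal (C * ∑ i, a i ^ 2)) := by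
  refine ⟨1 / 32, 2, by norm_num, by norm_num, fun n a σ hσ ha hmono =>
    ⟨existsUnique_isCriticalIndex hσ, fun k hk => ⟨?_, ?_⟩, fun hd => ?_⟩⟩
  · refine le_trans (ENNReal.ofReal_le_ofReal ?_) (le_gaussianMinimaxRisk_hyperrectangle hσ ha)
    linarith [min_le_sum_min_of_isCriticalIndex hσ ha hmono hk]
  · exact gaussianMinimaxRisk_hyperrectangle_le.trans
      (ENNReal.ofReal_le_ofReal (sum_min_le_of_isCriticalIndex hk))
  · have hsum : ∑ i, min (a i ^ 2) (σ ^ 2) = ∑ i, a i ^ 2 :=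
      Finset.sum_congr rfl fun i _ => min_eq_left <|
        (Finset.single_le_sum (f := fun i => a i ^ 2) (fun j _ => sq_nonneg _)
          (Finset.mem_univ i)).trans hd
    have hd0 : 0 ≤ ∑ i, a i ^ 2 := Finset.sum_nonneg fun i _ => sq_nonneg _
    constructor
    · refine le_trans (ENNReal.ofReal_le_ofReal ?_) (le_gaussianMinimaxRisk_hyperrectangle hσ ha)
      linarith
    · refine gaussianMinimaxRisk_hyperrectangle_le.trans (ENNReal.ofReal_le_ofReal ?_)
      linarith
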